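/- A graph is a finite CW complex of dimension at most $1$ (loops and multiple edges allowed). For a graph $\Gamma$ with a set $S$ of vertices, called sinks, and $k\ge 0$, let $F_k(\Gamma,S)\subseteq\Gamma^k$ be the subspace of all $k$-tuples $(x_1,\dots,x_k)$ such that $x_i=x_j$ with $i\ne j$ implies $x_i\in S$, and let $B_k(\Gamma,S)=F_k(\Gamma,S)/\Sigma_k$ be its quotient by the symmetric group. Let $\pi$ be an equivalence relation on a finite set $I$. The local graph $\Lambda(\pi)$ has vertices $v_0$ and $v_{c}$ for $c\in I/\pi$, and for each $i\in I$ one edge, joining $v_0$ to $v_{[i]}$. All its vertices except $v_0$ are sinks; write $B_k(\Lambda(\pi))$ for the resulting unordered configuration space. For $k\ge 0$ let $\Lambda_k(\pi)$ be the following graph. It has a vertex $v_p$ for every family $p=(p_c)_{c\in I/\pi}$ of non-negative integers with sum $k$ or $k-1$. If $p'$ is obtained from $p$ by replacing $p_c$ by $p_c-1$ for one class $c$ (both $v_p$ and $v_{p'}$ being vertices), then there is one edge joining $v_{p'}$ and $v_p$ for each $j\in c$. Define $f_k:\Lambda_k(\pi)\to B_k(\Lambda(\pi))$ as follows. The configuration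 $f_k(v_p)$ has $p_c$ particles at $v_c$ for each $c$ and, if $p$ has sum $k-1$, one further particle at $v_0$. On the edge from $v_{p'}$ to $v_p$ indexed by $j\in c$, $f_k$ is the path in which the particle at $v_0$ moves linearly onto $v_c$ along the edge $j$ of $\Lambda(\pi)$, while the other particles stay fixed. Proposition. For every finite set $I$, every equivalence relation $\pi$ on $I$ and every $k\ge 0$, the function $f_k:\Lambda_k(\pi)\to B_k(\Lambda(\pi))$ is a homotopy equivalence (in particular, it is continuous). Consequently, $B_k(\Lambda(\pi))$ is homotopy equivalent to a graph. -/

import Mathlib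

universe u v

/-- A graph (loops and multiple edges allowed) with vertex set `V` and edge set `E`. The two ends
of every edge are listed in some order, which serves only to parametrize the edge by `[0, 1]`. -/
structure TopGraph (V : Type u) (E : Type v) where
  /-- the end of an edge at parameter `0` -/
  src : E → V
  /-- the end of an edge at parameter `1` -/
  tgt : E → V

namespace TopGraph

variable {V : Type u} {E : Type v}

/-- The gluing relation: the ends of each edge are attached to vertices. -/
inductive Glue (G : TopGraph V E) : V ⊕ (E × unitInterval) → V ⊕ (E × unitInterval) → Prop
  | src (e : E) : Glue G (Sum.inr (e, 0)) (Sum.inl (G.src e))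
  | tgt (e : E) : Glue G (Sum.inr (e, 1)) (Sum.inl (G.tgt e))

/-- The graph as a topological space: the vertices together with one closed unit interval for each
edge, glued at the ends. -/
def Space (G : TopGraph V E) : Type (max u v) := Quot G.Glue

/-- The quotient topology, where the set of vertices and the set of edges are discrete. -/
instance (G : TopGraph V E) : TopologicalSpace G.Space :=
  letI : TopologicalSpace V := ⊥
  letI : TopologicalSpace E := ⊥
  inferInstanceAs (TopologicalSpace (Quot G.Glue))

/-- The point of the graph given by a vertex. -/
def vertex (G : TopGraph V E) (v : V) : G.Space := Quot.mk _ (Sum.inl v)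

/-- The point with parameter `t` on an edge. -/
def edgePoint (G : TopGraph V E) (e : E) (t : unitInterval) : G.Space := Quot.mk _ (Sum.inr (e, t))

theorem edgePoint_zero (G : TopGraph V E) (e : E) : G.edgePoint e 0 = G.vertex (G.src e) :=
  Quot.sound (Glue.src e)

theorem edgePoint_one (G : TopGraph V E) (e : E) : G.edgePoint e 1 = G.vertex (G.tgt e) :=
  Quot.sound (Glue.tgt e)

/-- The ordered configuration space `F_k(Γ, S)` of the graph with sinks `(Γ, S)`: `k`-tuples of
points of `Γ` in which distinct particles may coincide only at a sink. It carries the subspace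
topology of the product topology. -/
abbrev OrdConf (G : TopGraph V E) (S : Set V) (k : ℕ) : Type (max u v) :=
  {x : Fin k → G.Space // ∀ i j, i ≠ j → x i = x j → x i ∈ G.vertex '' S}

/-- Two ordered configurations are equivalent if they differ by a permutation of the labels. -/
def permSetoid (G : TopGraph V E) (S : Set V) (k : ℕ) : Setoid (G.OrdConf S k) where
  r x y := ∃ σ : Equiv.Perm (Fin k), y.1 = x.1 ∘ σ
  iseqv :=
    { refl := fun _ => ⟨1, rfl⟩
      symm := by
        rintro x y ⟨σ, h⟩
        exact ⟨σ⁻¹, by rw [h]; ext i; simp⟩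
      trans := by
        rintro x y z ⟨σ, h⟩ ⟨τ, h'⟩
        exact ⟨σ * τ, by rw [h', h]; rfl⟩ }

/-- The unordered configuration space `B_k(Γ, S)`: the quotient of `F_k(Γ, S)` by the symmetric
group, with the quotient topology. -/
def UnordConf (G : TopGraph V E) (S : Set V) (k : ℕ) : Type (max u v) :=
  Quotient (G.permSetoid S k)

instance (G : TopGraph V E) (S : Set V) (k : ℕ) : TopologicalSpace (G.UnordConf S k) :=
  inferInstanceAs (TopologicalSpace (Quotient (G.permSetoid S k)))

/-- The unordered configuration whose particles are the members of a multiset `m` with `k` elements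
in which only sinks are repeated. The enumeration `m.toList` of `m` is arbitrary; any other one
gives the same unordered configuration (see `ofMultiset_eq`). -/
noncomputable def ofMultiset (G : TopGraph V E) (S : Set V) (k : ℕ) (m : Multiset G.Space)
    (hk : m.card = k) (hS : ∀ x, Multiset.replicate 2 x ≤ m → x ∈ G.vertex '' S) :
    G.UnordConf S k :=
  Quotient.mk (G.permSetoid S k)
    ⟨fun i => m.toList.get (i.cast (by simp [hk])), by
      intro i j hij hx
      apply hS
      refine le_of_le_of_eq ?_ (Multiset.coe_toList m)
      rw [Multiset.replicate_le_coe, List.replicate_succ, List.replicate_one, ← List.duplicate_iff_sublist,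
        List.duplicate_iff_exists_distinct_get]
      rcases lt_or_gt_of_ne hij with h | h
      · exact ⟨i.cast (by simp [hk]), j.cast (by simp [hk]), h, by simp, by simpa using hx⟩
      · exact ⟨j.cast (by simp [hk]), i.cast (by simp [hk]), h, by simpa using hx, by simp⟩⟩

theorem ofMultiset_eq (G : TopGraph V E) (S : Set V) (k : ℕ) (x : G.OrdConf S k)
    (m : Multiset G.Space) (hk : m.card = k)
    (hS : ∀ x, Multiset.replicate 2 x ≤ m → x ∈ G.vertex '' S)
    (hx : m = Finset.univ.val.map x.1) :
    G.ofMultiset S k m hk hS = Quotient.mk (G.permSetoid S k) x := by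
  classical
  refine Quotient.sound ?_
  set f : Fin k → G.Space := fun i => m.toList.get (i.cast (by simp [hk])) with hf
  have hm : Finset.univ.val.map f = Finset.univ.val.map x.1 := by
    rw [← hx, Fin.univ_val_map]
    conv_rhs => rw [← Multiset.coe_toList m]
    congr 1
    apply List.ext_get
    · simp [hk]
    · intro n h1 h2
      simp [hf]
  have hc : ∀ a, Nonempty ({i // x.1 i = a} ≃ {i // f i = a}) := by
    intro a
    have h := congrArg (Multiset.count a) hm
    rw [Multiset.count_map, Multiset.count_map] at h
    refine Fintype.card_eq.1 ?_
    rw [Fintype.card_subtype, Fintype.card_subtype]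
    simp only [eq_comm (b := a)] at h ⊢
    exact h.symm
  refine ⟨Equiv.ofFiberEquiv fun a => (hc a).some, ?_⟩
  funext i
  exact (Equiv.ofFiberEquiv_map _ i).symm

end TopGraph

section LocalGraph

variable {ι : Type u}

/-- The local graph `Λ(π)` of an equivalence relation `π` on `ι`: the vertices are `v₀ = none` and
`v_c = some c` for every equivalence class `c`, and each `i : ι` is an edge joining `v₀`
to `v_[i]`. -/
def localGraph (π : Setoid ι) : TopGraph (Option (Quotient π)) ι where
  src _ := none
  tgt i := some (Quotient.mk π i)

/-- Every vertex of the local graph except `v₀` is a sink. -/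
def localSinks (π : Setoid ι) : Set (Option (Quotient π)) := {v | v ≠ none}

/-- The configuration space `B_k(Λ(π))` of the local graph with its sinks. -/
abbrev LocalConf (π : Setoid ι) (k : ℕ) : Type u :=
  (localGraph π).UnordConf (localSinks π) k

/-- The vertices of `Λ_k(π)`: families `p` of natural numbers indexed by the equivalence classes
(for finite `ι`, every family is finitely supported) with sum `k` or `k - 1`. For `k = 0` the
second case does not occur. -/
abbrev PartVertex (π : Setoid ι) (k : ℕ) : Type u :=
  {p : Quotient π →₀ ℕ // p.degree = k ∨ p.degree + 1 = k}

/-- The edges of `Λ_k(π)`: whenever `p'` arises from `p` on replacing `p_c` by `p_c - 1`, there is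
one edge joining `v_{p'}` to `v_p` for each `j` in the class `c`. -/
structure PartEdge (π : Setoid ι) (k : ℕ) : Type u where
  /-- the partition `p'` -/
  lower : PartVertex π k
  /-- the partition `p` -/
  upper : PartVertex π k
  /-- the index `j` -/
  label : ι
  upper_eq : upper.1 = lower.1 + Finsupp.single (Quotient.mk π label) 1

/-- The combinatorial graph `Λ_k(π)`. -/
def partGraph (π : Setoid ι) (k : ℕ) : TopGraph (PartVertex π k) (PartEdge π k) where
  src e := e.lower
  tgt e := e.upper

/-- The multiset of points of `Λ(π)` with `p_c` particles at the sink `v_c` for each class `c`. -/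
noncomputable def sinkParticles (π : Setoid ι) (p : Quotient π →₀ ℕ) :
    Multiset (localGraph π).Space :=
  (Finsupp.toMultiset p).map fun c => (localGraph π).vertex (some c)

theorem card_sinkParticles (π : Setoid ι) (p : Quotient π →₀ ℕ) :
    (sinkParticles π p).card = p.degree := by
  rw [sinkParticles, Multiset.card_map, Finsupp.card_toMultiset]
  rfl

theorem PartEdge.lower_degree {π : Setoid ι} {k : ℕ} (e : PartEdge π k) :
    e.lower.1.degree + 1 = k := by
  have h := congrArg Finsupp.degree e.upper_eq
  rw [map_add, Finsupp.degree_single] at h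
  have h1 := e.lower.2
  have h2 := e.upper.2
  omega

theorem PartEdge.upper_degree {π : Setoid ι} {k : ℕ} (e : PartEdge π k) :
    e.upper.1.degree = k := by
  have h := congrArg Finsupp.degree e.upper_eq
  rw [map_add, Finsupp.degree_single] at h
  have h1 := e.lower_degree
  omega

open Classical in
/-- The particles of `f_k(v_p)`: there are `p_c` of them at each `v_c`, and if `p` is a partition
of `k - 1`, there is one more at `v₀`. -/
noncomputable def vertexParticles (π : Setoid ι) (k : ℕ) (p : PartVertex π k) :
    Multiset (localGraph π).Space :=
  if p.1.degree = k then sinkParticles π p.1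
  else (localGraph π).vertex none ::ₘ sinkParticles π p.1

/-- The particles of `f_k` at parameter `t` on an edge from `v_{p'}` to `v_p` with index `j`:
there are `p'_c` of them at each `v_c`, and one more at parameter `t` on the edge `j` of `Λ(π)`,
moving linearly from `v₀` at `t = 0` to `v_[j]` at `t = 1`. -/
noncomputable def edgeParticles (π : Setoid ι) (k : ℕ) (e : PartEdge π k) (t : unitInterval) :
    Multiset (localGraph π).Space :=
  (localGraph π).edgePoint e.label t ::ₘ sinkParticles π e.lower.1

/-- The particles of `f_k` at a point of a vertex or an edge of `Λ_k(π)`. -/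
noncomputable def particles (π : Setoid ι) (k : ℕ) :
    PartVertex π k ⊕ (PartEdge π k × unitInterval) → Multiset (localGraph π).Space
  | Sum.inl p => vertexParticles π k p
  | Sum.inr (e, t) => edgeParticles π k e t

theorem card_particles (π : Setoid ι) (k : ℕ) (z : PartVertex π k ⊕ (PartEdge π k × unitInterval)) :
    (particles π k z).card = k := by
  rcases z with p | ⟨e, t⟩
  · rw [particles, vertexParticles]
    split_ifs with h
    · rw [card_sinkParticles, h]
    · rw [Multiset.card_cons, card_sinkParticles]
      exact p.2.resolve_left h
  · rw [particles, edgeParticles, Multiset.card_cons, card_sinkParticles, e.lower_degree]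

theorem mem_sinkParticles {π : Setoid ι} {p : Quotient π →₀ ℕ} {x : (localGraph π).Space}
    (hx : x ∈ sinkParticles π p) : x ∈ (localGraph π).vertex '' localSinks π := by
  obtain ⟨c, -, rfl⟩ := Multiset.mem_map.1 hx
  exact ⟨some c, Option.some_ne_none c, rfl⟩

theorem repeated_particles (π : Setoid ι) (k : ℕ) (z : PartVertex π k ⊕ (PartEdge π k × unitInterval))
    (x : (localGraph π).Space) (hx : Multiset.replicate 2 x ≤ particles π k z) :
    x ∈ (localGraph π).vertex '' localSinks π := by
  have key : ∀ (a : (localGraph π).Space) (p : Quotient π →₀ ℕ),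
      Multiset.replicate 2 x ≤ a ::ₘ sinkParticles π p →
        x ∈ (localGraph π).vertex '' localSinks π := by
    classical
    intro a p h
    have h2 := Multiset.le_count_iff_replicate_le.2 h
    rw [Multiset.count_cons] at h2
    refine mem_sinkParticles (p := p) (Multiset.count_pos.1 ?_)
    split_ifs at h2 <;> omega
  rcases z with p | ⟨e, t⟩
  · rw [particles, vertexParticles] at hx
    split_ifs at hx with h
    · exact mem_sinkParticles (Multiset.mem_of_le hx (by simp))
    · exact key _ _ hx
  · exact key _ _ hx

theorem particles_glue (π : Setoid ι) (k : ℕ) (z w : PartVertex π k ⊕ (PartEdge π k × unitInterval))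
    (h : (partGraph π k).Glue z w) : particles π k z = particles π k w := by
  cases h with
  | src e =>
    have h1 := e.lower_degree
    have h2 : ¬ e.lower.1.degree = k := by omega
    change edgeParticles π k e 0 = vertexParticles π k e.lower
    rw [edgeParticles, vertexParticles, if_neg h2, TopGraph.edgePoint_zero]
    rfl
  | tgt e =>
    change edgeParticles π k e 1 = vertexParticles π k e.upper
    rw [edgeParticles, vertexParticles, if_pos e.upper_degree, TopGraph.edgePoint_one,
      e.upper_eq, sinkParticles, sinkParticles, map_add, Finsupp.toMultiset_single, one_nsmul,
      Multiset.map_add, Multiset.map_singleton, add_comm, Multiset.singleton_add]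
    rfl

/-- The function `f_k : Λ_k(π) → B_k(Λ(π))`. -/
noncomputable def localMap (π : Setoid ι) (k : ℕ) : (partGraph π k).Space → LocalConf π k :=
  Quot.lift
    (fun z => (localGraph π).ofMultiset (localSinks π) k (particles π k z) (card_particles π k z)
      (repeated_particles π k z))
    (fun z w h => by
      have := particles_glue π k z w h
      congr 1)

end LocalGraph

/-! A configuration has at most one particle at `v₀`, since `v₀` is not a sink. Let `spread` be the
second smallest distance of its particles from `v₀`, counted with multiplicity; it is positive and
depends continuously on the configuration. Pushing all particles outwards, with truncation at the
sinks, by a factor growing from `1` to `1 / spread` brings all but at most one particle to sinks.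
The push creates collisions only at sinks (`push_eq_push`) and commutes with relabelling, so it
descends to a homotopy `flow` on the unordered space.

Configurations with at most one particle off the sinks are fixed at time `1`
(`ordFlow_one_of_isReduced`), and they form exactly the image of `localMap`: the exceptional
particle, if any, is at `v₀` or inside an edge `j`, which gives a vertex or an edge of `Λ_k(π)`. As
`localMap` is a continuous injection from a compact space into a Hausdorff space, it is an
embedding, and `flow` at time `1` followed by its inverse on the image is a homotopy inverse. -/

open Topology

/-! ### Graph spaces: continuity criteria and normal forms of points. -/

namespace TopGraph

variable {V : Type u} {E : Type v} (G : TopGraph V E)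

/-- The product of a quotient map with a locally compact space is again a quotient map. The
parameter space `P` accommodates the variable factor of `push`. -/
theorem continuous_prod_of_edges {X P : Type*} [TopologicalSpace X] [TopologicalSpace P]
    [LocallyCompactSpace P] {f : G.Space × P → X}
    (hv : ∀ v, Continuous fun p => f (G.vertex v, p))
    (he : ∀ e, Continuous fun q : unitInterval × P => f (G.edgePoint e q.1, q.2)) : Continuous f := by
  let _ : TopologicalSpace V := ⊥
  let _ : TopologicalSpace E := ⊥
  have : DiscreteTopology V := ⟨rfl⟩
  have : DiscreteTopology E := ⟨rfl⟩
  have hq : IsQuotientMap (Quot.mk G.Glue : _ → G.Space) := isQuotientMap_quot_mk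
  refine hq.continuous_lift_prod_left ?_
  rw [← Homeomorph.comp_continuous_iff' Homeomorph.sumProdDistrib.symm]
  refine continuous_sum_dom.2 ⟨?_, ?_⟩
  · exact continuous_prod_of_discrete_left.2 hv
  · rw [← Homeomorph.comp_continuous_iff' (Homeomorph.prodAssoc E unitInterval P).symm]
    exact continuous_prod_of_discrete_left.2 he

theorem continuous_of_edges {X : Type*} [TopologicalSpace X] {f : G.Space → X}
    (he : ∀ e, Continuous fun t => f (G.edgePoint e t)) : Continuous f :=
  (G.continuous_prod_of_edges (P := Unit) (f := fun q => f q.1)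
    (fun _ => continuous_of_discreteTopology) (fun e => (he e).comp continuous_fst)).comp (Continuous.prodMk_left ())

theorem continuous_edgePoint (e : E) : Continuous (G.edgePoint e) := by
  let _ : TopologicalSpace V := ⊥
  let _ : TopologicalSpace E := ⊥
  have hq : Continuous (Quot.mk G.Glue : _ → G.Space) := continuous_quot_mk
  exact hq.comp (continuous_inr.comp (Continuous.prodMk_right e))

theorem compactSpace_space [Finite V] [Finite E] : CompactSpace G.Space := by
  let _ : TopologicalSpace V := ⊥
  let _ : TopologicalSpace E := ⊥
  exact inferInstanceAs (CompactSpace (Quot G.Glue))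

theorem space_cases {p : G.Space → Prop} (x : G.Space) (hv : ∀ v, p (G.vertex v))
    (he : ∀ e t, 0 < t → t < 1 → p (G.edgePoint e t)) : p x := by
  rcases x with ⟨v | ⟨e, t⟩⟩
  · exact hv v
  · rcases eq_or_ne t 0 with rfl | h0
    · exact (congrArg p (G.edgePoint_zero e)).mpr (hv _)
    rcases eq_or_ne t 1 with rfl | h1
    · exact (congrArg p (G.edgePoint_one e)).mpr (hv _)
    exact he e t (unitInterval.pos_iff_ne_zero.2 h0) (unitInterval.lt_one_iff_ne_one.2 h1)

open Classical in
/-- The unique description of a point as a vertex or as an interior point of an edge. -/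
noncomputable def normalForm : G.Space → V ⊕ (E × unitInterval) :=
  Quot.lift (Sum.elim Sum.inl fun q =>
    if q.2 = 0 then Sum.inl (G.src q.1) else if q.2 = 1 then Sum.inl (G.tgt q.1) else Sum.inr q) (by
    rintro _ _ (e | e) <;> simp)

theorem normalForm_vertex (v : V) : G.normalForm (G.vertex v) = Sum.inl v := rfl

theorem normalForm_edgePoint (e : E) {t : unitInterval} (h0 : 0 < t) (h1 : t < 1) :
    G.normalForm (G.edgePoint e t) = Sum.inr (e, t) := by
  change (if t = 0 then _ else if t = 1 then _ else _) = _
  rw [if_neg h0.ne', if_neg h1.ne]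

theorem vertex_injective : Function.Injective G.vertex := fun v w h => by
  simpa [normalForm_vertex] using congrArg G.normalForm h

theorem edgePoint_ne_vertex (e : E) {t : unitInterval} (h0 : 0 < t) (h1 : t < 1) (v : V) :
    G.edgePoint e t ≠ G.vertex v := fun h => by
  simpa [normalForm_vertex, G.normalForm_edgePoint e h0 h1] using congrArg G.normalForm h

theorem edgePoint_inj {e e' : E} {t t' : unitInterval} (h0 : 0 < t) (h1 : t < 1) (h0' : 0 < t') (h1' : t' < 1)
    (h : G.edgePoint e t = G.edgePoint e' t') : e = e' ∧ t = t' := by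
  simpa [G.normalForm_edgePoint e h0 h1, G.normalForm_edgePoint e' h0' h1'] using
    congrArg G.normalForm h

/-! ### Quotient topology and multisets of particles for unordered configurations. -/

section Configurations

variable (S : Set V) (k : ℕ)

/-- The projection from ordered to unordered configurations. -/
def forget (x : G.OrdConf S k) : G.UnordConf S k := Quotient.mk (G.permSetoid S k) x

variable {S k}

theorem forget_eq_iff {x y : G.OrdConf S k} :
    G.forget S k x = G.forget S k y ↔ ∃ σ : Equiv.Perm (Fin k), y.1 = x.1 ∘ σ :=
  Quotient.eq (r := G.permSetoid S k)

variable (S k)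

theorem forget_surjective : Function.Surjective (G.forget S k) := Quotient.mk_surjective

/-- Relabelling the particles of an ordered configuration. -/
def relabel (σ : Equiv.Perm (Fin k)) (x : G.OrdConf S k) : G.OrdConf S k :=
  ⟨x.1 ∘ σ, fun i j hij h => x.2 (σ i) (σ j) (σ.injective.ne hij) h⟩

theorem continuous_relabel (σ : Equiv.Perm (Fin k)) : Continuous (G.relabel S k σ) := by
  have h : Continuous fun x : G.OrdConf S k => x.1 ∘ σ :=
    continuous_pi fun i => (continuous_apply (σ i)).comp continuous_subtype_val
  exact h.subtype_mk _

/-- The saturation of an open set is the union of its preimages under all relabellings. Openness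
allows Hausdorffness to be tested by closedness of the relation. -/
theorem isOpenQuotientMap_forget : IsOpenQuotientMap (G.forget S k) := by
  refine ⟨G.forget_surjective S k, continuous_quot_mk, fun U hU => ?_⟩
  have hq : IsQuotientMap (G.forget S k) := isQuotientMap_quot_mk
  rw [← hq.isOpen_preimage]
  have : G.forget S k ⁻¹' (G.forget S k '' U) = ⋃ σ, G.relabel S k σ ⁻¹' U := by
    ext x
    simp only [Set.mem_preimage, Set.mem_image, Set.mem_iUnion]
    constructor
    · rintro ⟨y, hy, h⟩
      obtain ⟨σ, hσ⟩ := G.forget_eq_iff.1 h.symm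
      refine ⟨σ, ?_⟩
      convert hy
      exact Subtype.ext hσ.symm
    · rintro ⟨σ, h⟩
      exact ⟨_, h, (G.forget_eq_iff.2 ⟨σ, rfl⟩).symm⟩
  rw [this]
  exact isOpen_iUnion fun σ => hU.preimage (G.continuous_relabel S k σ)

/-- The relation is a finite union, over permutations, of closed equalizers. -/
theorem t2Space_unordConf [T2Space G.Space] : T2Space (G.UnordConf S k) := by
  rw [t2Space_iff_of_isOpenQuotientMap (G.isOpenQuotientMap_forget S k)]
  simp only [forget_eq_iff, Set.ofPred_exists]
  refine isClosed_iUnion_of_finite fun σ => isClosed_eq ?_ ?_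
  · exact continuous_subtype_val.comp continuous_snd
  · exact continuous_pi fun i =>
      (continuous_apply (σ i)).comp (continuous_subtype_val.comp continuous_fst)

/-- The multiset of particles of an unordered configuration. -/
def toMultiset : G.UnordConf S k → Multiset G.Space :=
  Quotient.lift (fun x : G.OrdConf S k => Finset.univ.val.map x.1) (by
    rintro x y ⟨σ, h⟩
    rw [h, ← Multiset.map_map]
    congr 1
    exact (congrArg Finset.val (Finset.map_univ_equiv σ)).symm)

/-- This turns injectivity of `localMap` into a statement about multisets. -/
theorem toMultiset_ofMultiset (m : Multiset G.Space) (hk : m.card = k)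
    (hS : ∀ x, Multiset.replicate 2 x ≤ m → x ∈ G.vertex '' S) :
    G.toMultiset S k (G.ofMultiset S k m hk hS) = m := by
  change Finset.univ.val.map (fun i : Fin k => m.toList.get (i.cast (by simp [hk]))) = m
  rw [Fin.univ_val_map]
  conv_rhs => rw [← Multiset.coe_toList m]
  congr 1
  apply List.ext_get
  · simp [hk]
  · intro n h1 h2
    simp

end Configurations

end TopGraph

/-! ### Truncated stretching of the interval and of graph edges. -/

/-- Stretching the unit interval by the factor `max 1 b`, truncated at `1`. -/
noncomputable def stretch (b : ℝ) (t : unitInterval) : unitInterval :=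
  ⟨min 1 (t * max 1 b), le_min zero_le_one (mul_nonneg t.2.1 (le_max_of_le_left zero_le_one)),
    min_le_left _ _⟩

theorem stretch_zero (b : ℝ) : stretch b 0 = 0 := Subtype.ext (by simp [stretch])

theorem stretch_one (b : ℝ) : stretch b 1 = 1 := Subtype.ext (by simp [stretch])

theorem stretch_by_one (t : unitInterval) : stretch 1 t = t :=
  Subtype.ext (by simpa [stretch] using t.2.2)

theorem stretch_pos (b : ℝ) {t : unitInterval} (ht : 0 < t) : 0 < stretch b t :=
  Subtype.coe_lt_coe.1 (lt_min one_pos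
    (mul_pos (Subtype.coe_lt_coe.2 ht) (lt_max_of_lt_left one_pos)))

theorem stretch_inv_of_le {r t : unitInterval} (hr : 0 < r) (h : r ≤ t) :
    stretch (r : ℝ)⁻¹ t = 1 := by
  refine Subtype.ext (min_eq_left ?_)
  have hr' : (0 : ℝ) < r := hr
  calc (1 : ℝ) = r * (r : ℝ)⁻¹ := (mul_inv_cancel₀ hr'.ne').symm
    _ ≤ t * max 1 (r : ℝ)⁻¹ :=
      mul_le_mul h (le_max_right _ _) (inv_nonneg.2 hr'.le) t.2.1

/-- Below the truncation, `stretch b` is multiplication by a positive constant. -/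
theorem eq_of_stretch_eq {b : ℝ} {t t' : unitInterval} (h : stretch b t = stretch b t')
    (h1 : stretch b t < 1) : t = t' := by
  have e : min 1 ((t : ℝ) * max 1 b) = min 1 ((t' : ℝ) * max 1 b) := congrArg Subtype.val h
  have l : min 1 ((t : ℝ) * max 1 b) < 1 := h1
  have l' := e ▸ l
  rw [min_eq_right (min_lt_iff.1 l |>.resolve_left (lt_irrefl _)).le,
    min_eq_right (min_lt_iff.1 l' |>.resolve_left (lt_irrefl _)).le] at e
  exact Subtype.ext (mul_right_cancel₀ (lt_max_of_lt_left one_pos : 0 < max 1 b).ne' e)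

theorem continuous_stretch : Continuous fun q : unitInterval × ℝ => stretch q.2 q.1 :=
  Continuous.subtype_mk (by fun_prop) _

namespace TopGraph

variable {V : Type u} {E : Type v} (G : TopGraph V E)

/-- Pushing the points of a graph along its edges towards the targets by the factor `max 1 b`. -/
noncomputable def push (b : ℝ) : G.Space → G.Space :=
  Quot.lift (Sum.elim G.vertex fun q => G.edgePoint q.1 (stretch b q.2)) (by
    rintro _ _ (e | e)
    · simp [stretch_zero, edgePoint_zero]
    · simp [stretch_one, edgePoint_one])

theorem push_one (x : G.Space) : G.push 1 x = x := by
  rcases x with ⟨v | ⟨e, t⟩⟩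
  · rfl
  · exact congrArg (G.edgePoint e) (stretch_by_one t)

theorem continuous_push : Continuous fun q : G.Space × ℝ => G.push q.2 q.1 :=
  G.continuous_prod_of_edges (fun _ => continuous_const)
    (fun e => (G.continuous_edgePoint e).comp continuous_stretch)

end TopGraph

/-! ### Geometry of the local graph: sinks, radius, Hausdorffness. -/

namespace LocalGraph

open TopGraph

variable {ι : Type u} (π : Setoid ι)

/-- The set of points of the local graph which are sinks. -/
abbrev sinkPoints : Set (localGraph π).Space := (localGraph π).vertex '' localSinks π

theorem vertex_some_mem_sinkPoints (c : Quotient π) :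
    (localGraph π).vertex (some c) ∈ sinkPoints π := ⟨some c, Option.some_ne_none c, rfl⟩

theorem vertex_none_notMem_sinkPoints : (localGraph π).vertex none ∉ sinkPoints π := by
  rintro ⟨v, hv, h⟩
  exact hv ((localGraph π).vertex_injective h)

theorem edgePoint_notMem_sinkPoints (i : ι) {t : unitInterval} (h0 : 0 < t) (h1 : t < 1) :
    (localGraph π).edgePoint i t ∉ sinkPoints π := by
  rintro ⟨v, -, h⟩
  exact (localGraph π).edgePoint_ne_vertex i h0 h1 v h.symm

variable {π} in
theorem eq_vertex_of_mem_sinkPoints {x : (localGraph π).Space} (hx : x ∈ sinkPoints π) :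
    ∃ c, x = (localGraph π).vertex (some c) := by
  obtain ⟨v, hv, rfl⟩ := hx
  obtain ⟨c, rfl⟩ := Option.ne_none_iff_exists'.1 hv
  exact ⟨c, rfl⟩

/-- The distance from the central vertex. -/
def radius : (localGraph π).Space → unitInterval :=
  Quot.lift (Sum.elim (fun v => v.elim 0 fun _ => 1) Prod.snd) (by
    rintro _ _ (e | e) <;> rfl)

theorem continuous_radius : Continuous (radius π) :=
  (localGraph π).continuous_of_edges fun _ => continuous_id

theorem radius_eq_one_iff (x : (localGraph π).Space) : radius π x = 1 ↔ x ∈ sinkPoints π := by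
  induction x using (localGraph π).space_cases with
  | hv v =>
    rcases v with _ | c
    · exact iff_of_false zero_ne_one (vertex_none_notMem_sinkPoints π)
    · exact iff_of_true rfl (vertex_some_mem_sinkPoints π c)
  | he i t h0 h1 => exact iff_of_false h1.ne (edgePoint_notMem_sinkPoints π i h0 h1)

theorem eq_center_of_radius_eq_zero {x : (localGraph π).Space} (hx : radius π x = 0) :
    x = (localGraph π).vertex none := by
  induction x using (localGraph π).space_cases with
  | hv v =>
    rcases v with _ | c
    · rfl
    · exact absurd hx one_ne_zero
  | he i t h0 h1 => exact absurd hx h0.ne'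

theorem radius_push (b : ℝ) (x : (localGraph π).Space) :
    radius π ((localGraph π).push b x) = stretch b (radius π x) := by
  rcases x with ⟨(_ | c) | ⟨i, t⟩⟩
  · exact (stretch_zero b).symm
  · exact (stretch_one b).symm
  · rfl

/-- `push` keeps each point on its edge and is injective in the radius until it reaches `1`, so
points can merge only at sinks. -/
theorem push_eq_push {b : ℝ} {x y : (localGraph π).Space}
    (h : (localGraph π).push b x = (localGraph π).push b y) :
    x = y ∨ (localGraph π).push b x ∈ sinkPoints π := by
  rw [or_iff_not_imp_right, ← radius_eq_one_iff, radius_push]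
  intro hx
  have hr := congrArg (radius π) h
  rw [radius_push, radius_push] at hr
  have hxy := eq_of_stretch_eq hr (lt_of_le_of_ne unitInterval.le_one' hx)
  induction x using (localGraph π).space_cases with
  | hv v =>
    rcases v with _ | c
    · exact (eq_center_of_radius_eq_zero π hxy.symm).symm
    · exact absurd (stretch_one b) hx
  | he i t h0 h1 =>
    induction y using (localGraph π).space_cases with
    | hv v =>
      rcases v with _ | c
      · exact eq_center_of_radius_eq_zero π hxy
      · exact absurd (hr.trans (stretch_one b)) hx
    | he j s h0' h1' =>
      have hx' := lt_of_le_of_ne unitInterval.le_one' hx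
      exact congrArg₂ _ ((localGraph π).edgePoint_inj (stretch_pos b h0) hx' (stretch_pos b h0')
        (hr ▸ hx') h).1 hxy

open Classical in
/-- Coordinates embedding the local graph into a Euclidean space. -/
noncomputable def coordinates : (localGraph π).Space → (Quotient π → ℝ) × (ι → ℝ) :=
  Quot.lift (Sum.elim (fun v => (fun c => if v = some c then 1 else 0, 0))
    fun q => (fun c => if Quotient.mk π q.1 = c then (q.2 : ℝ) else 0,
      fun i => if q.1 = i then (q.2 : ℝ) * (1 - q.2) else 0)) (by
    rintro _ _ (e | e) <;> simp [localGraph] <;> rfl)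

theorem continuous_coordinates : Continuous (coordinates π) := by
  classical
  refine (localGraph π).continuous_of_edges fun e => ?_
  refine (continuous_pi fun c => ?_).prodMk (continuous_pi fun i => ?_)
  · change Continuous fun t : unitInterval => if Quotient.mk π e = c then (t : ℝ) else 0
    split_ifs <;> fun_prop
  · change Continuous fun t : unitInterval => if e = i then (t : ℝ) * (1 - t) else 0
    split_ifs <;> fun_prop

/-- The coordinate `t * (1 - t)` is nonzero exactly inside its own edge and so identifies the edge,
even among edges with the same two ends; the class coordinate then recovers `t`. -/
theorem coordinates_injective : Function.Injective (coordinates π) := by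
  classical
  have pos : ∀ {t : unitInterval}, 0 < t → t < 1 → (0 : ℝ) < t * (1 - t) := fun h0 h1 =>
    mul_pos h0 (sub_pos.2 h1)
  intro x y h
  induction x using (localGraph π).space_cases with
  | hv v =>
    induction y using (localGraph π).space_cases with
    | hv w =>
      have h' : ∀ c, (if v = some c then (1 : ℝ) else 0) = if w = some c then 1 else 0 :=
        fun c => congrFun (congrArg Prod.fst h) c
      congr 1
      refine Option.ext fun c => ?_
      have := h' c
      split_ifs at this <;> simp_all
    | he j s h0 h1 =>
      have h' : (0 : ℝ) = if j = j then (s : ℝ) * (1 - s) else 0 :=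
        congrFun (congrArg Prod.snd h) j
      rw [if_pos rfl] at h'
      exact absurd h' (pos h0 h1).ne
  | he i t h0 h1 =>
    have h' := congrFun (congrArg Prod.snd h) i
    induction y using (localGraph π).space_cases with
    | hv w =>
      change (if i = i then (t : ℝ) * (1 - t) else 0) = 0 at h'
      rw [if_pos rfl] at h'
      exact absurd h' (pos h0 h1).ne'
    | he j s h0' h1' =>
      change (if i = i then (t : ℝ) * (1 - t) else 0) = if j = i then (s : ℝ) * (1 - s) else 0 at h'
      rw [if_pos rfl] at h'
      split_ifs at h' with hj
      · subst hj
        have h2 : (if Quotient.mk π j = Quotient.mk π j then (t : ℝ) else 0) =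
            if Quotient.mk π j = Quotient.mk π j then (s : ℝ) else 0 :=
          congrFun (congrArg Prod.fst h) (Quotient.mk π j)
        rw [if_pos rfl, if_pos rfl] at h2
        exact congrArg _ (Subtype.ext h2)
      · exact absurd h' (pos h0 h1).ne'

theorem t2Space_localGraph : T2Space (localGraph π).Space :=
  T2Space.of_injective_continuous (coordinates_injective π) (continuous_coordinates π)

/-! ### The deformation pushing all but one particle into the sinks. -/

section Flow

variable {π} {k : ℕ}

/-- The smallest radius which is attained or exceeded by all but one particle. -/
noncomputable def spread (x : (localGraph π).OrdConf (localSinks π) k) : unitInterval :=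
  Finset.univ.offDiag.inf fun p => max (radius π (x.1 p.1)) (radius π (x.1 p.2))

theorem spread_le (x : (localGraph π).OrdConf (localSinks π) k) {i j : Fin k} (h : i ≠ j) :
    spread x ≤ max (radius π (x.1 i)) (radius π (x.1 j)) :=
  Finset.inf_le (f := fun p : Fin k × Fin k => max (radius π (x.1 p.1)) (radius π (x.1 p.2)))
    (b := (i, j)) (by simpa using h)

theorem continuous_spread :
    Continuous (spread : (localGraph π).OrdConf (localSinks π) k → unitInterval) := by
  refine Continuous.finset_inf_apply fun p _ => ?_
  have h : ∀ i : Fin k, Continuous fun x : (localGraph π).OrdConf (localSinks π) k =>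
      radius π (x.1 i) := fun i =>
    (continuous_radius π).comp ((continuous_apply i).comp continuous_subtype_val)
  exact (h p.1).max (h p.2)

/-- Two particles of radius `0` would collide at `v₀`, which is not a sink. For `k ≤ 1` there are no
pairs, and the infimum is `⊤ = 1`. -/
theorem spread_pos (x : (localGraph π).OrdConf (localSinks π) k) : 0 < spread x := by
  refine (Finset.lt_inf_iff (by exact zero_lt_one)).2 fun p hp => ?_
  have hne : p.1 ≠ p.2 := (Finset.mem_offDiag.1 hp).2.2
  by_contra h
  rw [not_lt, max_le_iff] at h
  have h1 := eq_center_of_radius_eq_zero π (le_antisymm h.1 unitInterval.nonneg')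
  have h2 := eq_center_of_radius_eq_zero π (le_antisymm h.2 unitInterval.nonneg')
  exact vertex_none_notMem_sinkPoints π (h1 ▸ x.2 _ _ hne (h1.trans h2.symm))

theorem spread_relabel (σ : Equiv.Perm (Fin k)) (x : (localGraph π).OrdConf (localSinks π) k) :
    spread ((localGraph π).relabel _ k σ x) = spread x := by
  have key : ∀ (τ : Equiv.Perm (Fin k)) (y : (localGraph π).OrdConf (localSinks π) k),
      spread y ≤ spread ((localGraph π).relabel _ k τ y) := fun τ y =>
    Finset.le_inf fun p hp => spread_le y (τ.injective.ne (Finset.mem_offDiag.1 hp).2.2)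
  refine le_antisymm ?_ (key σ x)
  have e : (localGraph π).relabel _ k σ⁻¹ ((localGraph π).relabel _ k σ x) = x :=
    Subtype.ext (funext fun i => by simp [relabel])
  exact (key σ⁻¹ ((localGraph π).relabel _ k σ x)).trans_eq (congrArg spread e)

/-- The factor by which the particles are pushed outwards at time `s`. -/
noncomputable def factor (s : unitInterval) (x : (localGraph π).OrdConf (localSinks π) k) : ℝ :=
  (1 - s + s * spread x : ℝ)⁻¹

theorem factor_zero (x : (localGraph π).OrdConf (localSinks π) k) : factor 0 x = 1 := by
  simp [factor]

theorem factor_one (x : (localGraph π).OrdConf (localSinks π) k) :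
    factor 1 x = (spread x : ℝ)⁻¹ := by
  simp [factor]

theorem continuous_factor : Continuous fun q : unitInterval ×
    (localGraph π).OrdConf (localSinks π) k => factor q.1 q.2 := by
  have := continuous_spread (π := π) (k := k)
  refine Continuous.inv₀ (by fun_prop) fun q => ?_
  have h0 : (0 : ℝ) < spread q.2 := spread_pos q.2
  have h1 : (spread q.2 : ℝ) ≤ 1 := (spread q.2).2.2
  have h2 : (0 : ℝ) ≤ q.1 := q.1.2.1
  have h3 : (q.1 : ℝ) ≤ 1 := q.1.2.2
  -- The denominator is a convex combination of `1` and the positive number `spread q.2`.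
  have : 0 < (1 - q.1 + q.1 * spread q.2 : ℝ) := by nlinarith
  exact this.ne'

/-- The deformation of ordered configurations pushing all but one particle into the sinks. -/
noncomputable def ordFlow (s : unitInterval) (x : (localGraph π).OrdConf (localSinks π) k) :
    (localGraph π).OrdConf (localSinks π) k :=
  ⟨fun i => (localGraph π).push (factor s x) (x.1 i), fun i j hij h => by
    -- A collision that was already present is at a sink, and `push` fixes sinks; a new one is at a
    -- sink by `push_eq_push`.
    rcases push_eq_push π h with h' | h'
    · obtain ⟨c, hc⟩ := eq_vertex_of_mem_sinkPoints (x.2 i j hij h')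
      change (localGraph π).push (factor s x) (x.1 i) ∈ _
      rw [hc]
      exact vertex_some_mem_sinkPoints π c
    · exact h'⟩

theorem continuous_ordFlow : Continuous fun q : unitInterval ×
    (localGraph π).OrdConf (localSinks π) k => ordFlow q.1 q.2 := by
  have h : Continuous fun q : unitInterval × (localGraph π).OrdConf (localSinks π) k =>
      fun i => (localGraph π).push (factor q.1 q.2) (q.2.1 i) :=
    continuous_pi fun i => (localGraph π).continuous_push.comp
      (((continuous_apply i).comp (continuous_subtype_val.comp continuous_snd)).prodMk
        continuous_factor)
  exact h.subtype_mk _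

theorem ordFlow_relabel (s : unitInterval) (σ : Equiv.Perm (Fin k))
    (x : (localGraph π).OrdConf (localSinks π) k) :
    ordFlow s ((localGraph π).relabel _ k σ x) = (localGraph π).relabel _ k σ (ordFlow s x) := by
  refine Subtype.ext (funext fun i => ?_)
  simp only [ordFlow, factor, spread_relabel]
  rfl

/-- The deformation of unordered configurations induced by `ordFlow`. -/
noncomputable def flow (q : unitInterval × LocalConf π k) : LocalConf π k :=
  Quotient.map (ordFlow q.1) (by
    rintro x y ⟨σ, h⟩
    obtain rfl : y = (localGraph π).relabel _ k σ x := Subtype.ext h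
    rw [ordFlow_relabel]
    exact ⟨σ, rfl⟩) q.2

theorem flow_forget (s : unitInterval) (x : (localGraph π).OrdConf (localSinks π) k) :
    flow (s, (localGraph π).forget _ k x) = (localGraph π).forget _ k (ordFlow s x) := rfl

/-- The unit interval is locally compact, so its product with the quotient map `forget` is still a
quotient map. -/
theorem continuous_flow : Continuous (flow : unitInterval × LocalConf π k → LocalConf π k) := by
  have hq := (localGraph π).isOpenQuotientMap_forget (localSinks π) k
  exact hq.isQuotientMap.continuous_lift_prod_right (hq.continuous.comp continuous_ordFlow)

theorem flow_zero (y : LocalConf π k) : flow (0, y) = y := by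
  obtain ⟨x, rfl⟩ := (localGraph π).forget_surjective _ k y
  rw [flow_forget]
  congr 1
  refine Subtype.ext (funext fun i => ?_)
  change (localGraph π).push (factor 0 x) (x.1 i) = x.1 i
  rw [factor_zero, push_one]

/-- In a configuration of this kind, at most one particle is not at a sink. -/
def IsReduced (x : (localGraph π).OrdConf (localSinks π) k) : Prop :=
  ∀ i j, i ≠ j → x.1 i ∈ sinkPoints π ∨ x.1 j ∈ sinkPoints π

/-- At time `1` the factor is `1 / spread`, which carries every particle of radius at least `spread`
to a sink; any two particles include one of these. -/
theorem isReduced_ordFlow_one (x : (localGraph π).OrdConf (localSinks π) k) :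
    IsReduced (ordFlow 1 x) := by
  have key : ∀ i, spread x ≤ radius π (x.1 i) → (ordFlow 1 x).1 i ∈ sinkPoints π := by
    intro i hi
    change (localGraph π).push (factor 1 x) (x.1 i) ∈ _
    rw [← radius_eq_one_iff, radius_push, factor_one]
    exact stretch_inv_of_le (spread_pos x) hi
  intro i j hij
  exact (le_max_iff.1 (spread_le x hij)).imp (key i) (key j)

/-- Every pair contains a particle of radius `1`, so `spread` is `1` and the factor is trivial. -/
theorem ordFlow_one_of_isReduced {x : (localGraph π).OrdConf (localSinks π) k}
    (hx : IsReduced x) : ordFlow 1 x = x := by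
  have h1 : spread x = 1 := by
    refine le_antisymm unitInterval.le_one' (Finset.le_inf fun p hp => ?_)
    have := hx _ _ (Finset.mem_offDiag.1 hp).2.2
    rw [← radius_eq_one_iff, ← radius_eq_one_iff] at this
    rcases this with h | h <;> simp [h]
  refine Subtype.ext (funext fun i => ?_)
  change (localGraph π).push (factor 1 x) (x.1 i) = x.1 i
  rw [factor_one, h1]
  simp [push_one]

end Flow

/-! ### Finiteness of `Λ_k(π)` and continuity of `localMap`. -/

section LocalMap

variable (k : ℕ)

theorem finite_partVertex [Finite ι] : Finite (PartVertex π k) := by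
  refine Set.Finite.subset (Finsupp.finite_of_degree_le (σ := Quotient π) k) ?_
  rintro p (h | h)
  · exact h.le
  · change p.degree ≤ k
    omega

theorem finite_partEdge [Finite ι] : Finite (PartEdge π k) := by
  have := finite_partVertex π k
  refine Finite.of_injective
    (fun e : PartEdge π k => ((e.lower, e.upper, e.label) : PartVertex π k × PartVertex π k × ι)) ?_
  rintro ⟨a, b, c, h⟩ ⟨a', b', c', h'⟩ heq
  simp only [Prod.mk.injEq] at heq
  obtain ⟨rfl, rfl, rfl⟩ := heq
  rfl

variable {π k} in
theorem localMap_vertex_eq {p : PartVertex π k} {x : (localGraph π).OrdConf (localSinks π) k}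
    (h : vertexParticles π k p = Finset.univ.val.map x.1) :
    localMap π k ((partGraph π k).vertex p) = (localGraph π).forget _ k x :=
  (localGraph π).ofMultiset_eq _ k x _
    (card_particles π k (Sum.inl p)) (repeated_particles π k (Sum.inl p)) h

variable {π k} in
theorem localMap_edgePoint_eq {e : PartEdge π k} {t : unitInterval}
    {x : (localGraph π).OrdConf (localSinks π) k}
    (h : edgeParticles π k e t = Finset.univ.val.map x.1) :
    localMap π k ((partGraph π k).edgePoint e t) = (localGraph π).forget _ k x :=
  (localGraph π).ofMultiset_eq _ k x _
    (card_particles π k (Sum.inr (e, t))) (repeated_particles π k (Sum.inr (e, t))) h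

theorem toMultiset_localMap_vertex (p : PartVertex π k) :
    (localGraph π).toMultiset _ k (localMap π k ((partGraph π k).vertex p)) =
      vertexParticles π k p :=
  (localGraph π).toMultiset_ofMultiset _ k _
    (card_particles π k (Sum.inl p)) (repeated_particles π k (Sum.inl p))

theorem toMultiset_localMap_edgePoint (e : PartEdge π k) (t : unitInterval) :
    (localGraph π).toMultiset _ k (localMap π k ((partGraph π k).edgePoint e t)) =
      edgeParticles π k e t :=
  (localGraph π).toMultiset_ofMultiset _ k _
    (card_particles π k (Sum.inr (e, t))) (repeated_particles π k (Sum.inr (e, t)))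

theorem continuous_localMap : Continuous (localMap π k) := by
  refine (partGraph π k).continuous_of_edges fun e => ?_
  -- The enumeration chosen by `ofMultiset` need not vary continuously with `t`. The path is lifted
  -- to ordered configurations instead: the moving particle gets label `0`, and a fixed list orders
  -- the others.
  set l := (sinkParticles π e.lower.1).toList with hl
  have hlen : l.length + 1 = k := by
    rw [hl, Multiset.length_toList, card_sinkParticles, e.lower_degree]
  let x : unitInterval → Fin k → (localGraph π).Space := fun t i =>
    ((localGraph π).edgePoint e.label t :: l).get (i.cast (by simp [hlen]))
  have hm : ∀ t, edgeParticles π k e t = Finset.univ.val.map (x t) := by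
    intro t
    rw [Fin.univ_val_map, edgeParticles]
    conv_lhs => rw [← Multiset.coe_toList (sinkParticles π e.lower.1), ← hl, Multiset.cons_coe]
    congr 1
    apply List.ext_get
    · simp [hlen]
    · intro n h1 h2
      simp [x]
  have hS : ∀ t i j, i ≠ j → x t i = x t j → x t i ∈ sinkPoints π := by
    have key : ∀ t (i : Fin k), i.1 ≠ 0 → x t i ∈ sinkPoints π := by
      rintro t ⟨_ | i, hi⟩ h
      · exact absurd rfl h
      · exact mem_sinkParticles (Multiset.mem_toList.1 (List.get_mem l _))
    intro t i j hij h
    by_cases hi : i.1 = 0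
    · rw [h]
      exact key t j fun hj => hij (Fin.ext (hi.trans hj.symm))
    · exact key t i hi
  have hx : Continuous x := by
    refine continuous_pi fun i => ?_
    rcases i with ⟨_ | i, hi⟩
    · exact (localGraph π).continuous_edgePoint e.label
    · exact continuous_of_const fun _ _ => rfl
  have heq : (fun t => localMap π k ((partGraph π k).edgePoint e t)) =
      fun t => (localGraph π).forget (localSinks π) k ⟨x t, hS t⟩ :=
    funext fun t => localMap_edgePoint_eq (x := ⟨x t, hS t⟩) (hm t)
  rw [heq]
  exact ((localGraph π).isOpenQuotientMap_forget (localSinks π) k).continuous.comp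
    (hx.subtype_mk fun t => hS t)

/-! ### Injectivity of `localMap`. -/

section Injectivity

variable {π}

open Classical in
theorem count_sinkParticles (p : Quotient π →₀ ℕ) (c : Quotient π) :
    (sinkParticles π p).count ((localGraph π).vertex (some c)) = p c := by
  have h : Function.Injective fun c : Quotient π => (localGraph π).vertex (some c) :=
    (localGraph π).vertex_injective.comp (Option.some_injective _)
  exact (Multiset.count_map_eq_count' _ _ h c).trans (Finsupp.count_toMultiset p c)

theorem sinkParticles_injective : Function.Injective (sinkParticles π) := fun p q h => by
  classical
  ext c
  rw [← count_sinkParticles, h, count_sinkParticles]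

/-- The only particle off the sinks can be recognized in the multiset and cancelled; the
multiplicities at the sinks then give the family. -/
theorem cons_sinkParticles_injective {x y : (localGraph π).Space} {p q : Quotient π →₀ ℕ}
    (hx : x ∉ sinkPoints π) (hy : y ∉ sinkPoints π)
    (h : x ::ₘ sinkParticles π p = y ::ₘ sinkParticles π q) : x = y ∧ p = q := by
  have hxy : x = y := by
    have : x ∈ y ::ₘ sinkParticles π q := h ▸ Multiset.mem_cons_self _ _
    exact (Multiset.mem_cons.1 this).resolve_right fun h' => hx (mem_sinkParticles h')
  subst hxy
  exact ⟨rfl, sinkParticles_injective ((Multiset.cons_inj_right _).1 h)⟩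

theorem cons_ne_sinkParticles {x : (localGraph π).Space} {p q : Quotient π →₀ ℕ}
    (hx : x ∉ sinkPoints π) : x ::ₘ sinkParticles π p ≠ sinkParticles π q := fun h =>
  hx (mem_sinkParticles (h ▸ Multiset.mem_cons_self x _))

theorem vertexParticles_injective : Function.Injective (vertexParticles π k) := by
  intro p q h
  have h0 := vertex_none_notMem_sinkPoints π
  unfold vertexParticles at h
  split_ifs at h with hp hq hq
  · exact Subtype.ext (sinkParticles_injective h)
  · exact absurd h.symm (cons_ne_sinkParticles h0)
  · exact absurd h (cons_ne_sinkParticles h0)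
  · exact Subtype.ext (cons_sinkParticles_injective h0 h0 h).2

theorem edgeParticles_ne_vertexParticles (e : PartEdge π k) {t : unitInterval} (h0 : 0 < t)
    (h1 : t < 1) (p : PartVertex π k) : edgeParticles π k e t ≠ vertexParticles π k p := by
  have hx := edgePoint_notMem_sinkPoints π e.label h0 h1
  unfold edgeParticles vertexParticles
  split_ifs with hp
  · exact cons_ne_sinkParticles hx
  · exact fun h => (localGraph π).edgePoint_ne_vertex _ h0 h1 _
      (cons_sinkParticles_injective hx (vertex_none_notMem_sinkPoints π) h).1

theorem localMap_injective : Function.Injective (localMap π k) := by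
  intro z w h
  have h' := congrArg ((localGraph π).toMultiset (localSinks π) k) h
  induction z using (partGraph π k).space_cases with
  | hv p =>
    induction w using (partGraph π k).space_cases with
    | hv q =>
      rw [toMultiset_localMap_vertex, toMultiset_localMap_vertex] at h'
      rw [vertexParticles_injective k h']
    | he e t h0 h1 =>
      rw [toMultiset_localMap_vertex, toMultiset_localMap_edgePoint] at h'
      exact absurd h'.symm (edgeParticles_ne_vertexParticles k e h0 h1 p)
  | he e t h0 h1 =>
    induction w using (partGraph π k).space_cases with
    | hv q =>
      rw [toMultiset_localMap_vertex, toMultiset_localMap_edgePoint] at h'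
      exact absurd h' (edgeParticles_ne_vertexParticles k e h0 h1 q)
    | he e' t' h0' h1' =>
      rw [toMultiset_localMap_edgePoint, toMultiset_localMap_edgePoint] at h'
      obtain ⟨hx, hp⟩ := cons_sinkParticles_injective
        (edgePoint_notMem_sinkPoints π e.label h0 h1)
        (edgePoint_notMem_sinkPoints π e'.label h0' h1') h'
      obtain ⟨hl, rfl⟩ := (localGraph π).edgePoint_inj h0 h1 h0' h1' hx
      congr 1
      -- An edge is determined by its lower end and its label, since `upper_eq` forces the upper
      -- end.
      obtain ⟨⟨a, ha⟩, ⟨b, hb⟩, c, hc⟩ := e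
      obtain ⟨⟨a', ha'⟩, ⟨b', hb'⟩, c', hc'⟩ := e'
      dsimp only at hl hp hc hc'
      subst hl hp hc hc'
      rfl

end Injectivity

/-! ### The image of `localMap` is the set of reduced configurations. -/

section Range

variable {π k}

/-- Two particles off the sinks would both equal `a`, hence collide off the sinks. The inequality
also covers configurations lying wholly in the sinks. -/
theorem isReduced_of_le_cons {x : (localGraph π).OrdConf (localSinks π) k}
    {a : (localGraph π).Space} {p : Quotient π →₀ ℕ}
    (h : Finset.univ.val.map x.1 ≤ a ::ₘ sinkParticles π p) : IsReduced x := by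
  classical
  intro i j hij
  by_contra! hn
  have hmem : ∀ i, x.1 i ∉ sinkPoints π → x.1 i = a := fun i hi =>
    (Multiset.mem_cons.1 (Multiset.mem_of_le h
      (Multiset.mem_map_of_mem x.1 (Finset.mem_univ i)))).resolve_right
        fun h' => hi (mem_sinkParticles h')
  exact hn.1 (x.2 i j hij ((hmem i hn.1).trans (hmem j hn.2).symm))

theorem isReduced_of_forget_eq_localMap {x : (localGraph π).OrdConf (localSinks π) k}
    {z : (partGraph π k).Space} (h : (localGraph π).forget _ k x = localMap π k z) :
    IsReduced x := by
  have h' : Finset.univ.val.map x.1 = _ := congrArg ((localGraph π).toMultiset (localSinks π) k) h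
  induction z using (partGraph π k).space_cases with
  | hv p =>
    rw [toMultiset_localMap_vertex, vertexParticles] at h'
    split_ifs at h' with hp
    · exact isReduced_of_le_cons (a := (localGraph π).vertex none)
        (h'.le.trans (Multiset.le_cons_self _ _))
    · exact isReduced_of_le_cons h'.le
  | he e t h0 h1 =>
    rw [toMultiset_localMap_edgePoint] at h'
    exact isReduced_of_le_cons h'.le

theorem exists_sinkParticles_eq (m : Multiset (localGraph π).Space) (hm : ∀ x ∈ m, x ∈ sinkPoints π) :
    ∃ p, sinkParticles π p = m := by
  induction m using Multiset.induction with
  | empty => exact ⟨0, by simp [sinkParticles]⟩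
  | cons x m ih =>
    obtain ⟨p, rfl⟩ := ih fun y hy => hm y (Multiset.mem_cons_of_mem hy)
    obtain ⟨c, rfl⟩ := eq_vertex_of_mem_sinkPoints (hm x (Multiset.mem_cons_self _ _))
    exact ⟨Finsupp.single c 1 + p, by simp [sinkParticles]⟩

theorem forget_mem_range_localMap {x : (localGraph π).OrdConf (localSinks π) k}
    (hx : IsReduced x) : (localGraph π).forget _ k x ∈ Set.range (localMap π k) := by
  classical
  have hcard : (Finset.univ.val.map x.1).card = k := by simp
  by_cases hall : ∀ i, x.1 i ∈ sinkPoints π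
  · obtain ⟨p, hp⟩ := exists_sinkParticles_eq (Finset.univ.val.map x.1) (by simpa using hall)
    have hd : p.degree = k := by rw [← card_sinkParticles, hp, hcard]
    refine ⟨(partGraph π k).vertex ⟨p, Or.inl hd⟩, ?_⟩
    refine localMap_vertex_eq ?_
    rw [vertexParticles, if_pos hd, hp]
  · push Not at hall
    obtain ⟨i₀, hi₀⟩ := hall
    obtain ⟨p, hp⟩ := exists_sinkParticles_eq ((Finset.univ.erase i₀).val.map x.1) (by
      simp only [Multiset.mem_map, Finset.mem_val, Finset.mem_erase]
      rintro _ ⟨i, ⟨hi, -⟩, rfl⟩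
      exact (hx i i₀ hi).resolve_right hi₀)
    have hm : Finset.univ.val.map x.1 = x.1 i₀ ::ₘ sinkParticles π p := by
      rw [hp, ← Multiset.map_cons]
      congr 1
      rw [Finset.erase_val, Multiset.cons_erase (Finset.mem_univ i₀)]
    have hd : p.degree + 1 = k := by
      rw [← card_sinkParticles, ← Multiset.card_cons, ← hm, hcard]
    -- The exceptional position becomes a variable, open to case analysis: the centre gives a vertex
    -- with sum `k - 1`, an interior point of edge `j` gives an edge of `Λ_k(π)` labelled `j`.
    obtain ⟨y, hy⟩ : ∃ y, y = x.1 i₀ := ⟨_, rfl⟩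
    rw [← hy] at hm hi₀
    induction y using (localGraph π).space_cases with
    | hv v =>
      rcases v with _ | c
      · refine ⟨(partGraph π k).vertex ⟨p, Or.inr hd⟩, ?_⟩
        refine localMap_vertex_eq ?_
        rw [vertexParticles, if_neg (by dsimp only; omega), hm]
      · exact absurd (vertex_some_mem_sinkPoints π c) hi₀
    | he j t h0 h1 =>
      let e : PartEdge π k := ⟨⟨p, Or.inr hd⟩, ⟨p + Finsupp.single (Quotient.mk π j) 1, Or.inl (by
        rw [map_add, Finsupp.degree_single, hd])⟩, j, rfl⟩
      exact ⟨(partGraph π k).edgePoint e t, localMap_edgePoint_eq (e := e) hm.symm⟩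

theorem flow_one_mem_range (y : LocalConf π k) : flow (1, y) ∈ Set.range (localMap π k) := by
  obtain ⟨x, rfl⟩ := (localGraph π).forget_surjective _ k y
  exact forget_mem_range_localMap (isReduced_ordFlow_one x)

theorem flow_one_localMap (z : (partGraph π k).Space) :
    flow (1, localMap π k z) = localMap π k z := by
  obtain ⟨x, hx⟩ := (localGraph π).forget_surjective _ k (localMap π k z)
  rw [← hx, flow_forget, ordFlow_one_of_isReduced (isReduced_of_forget_eq_localMap hx)]

end Range

/-! ### The homotopy equivalence. -/

/-- Finiteness of `ι` makes `Λ_k(π)` a finite graph, hence compact; a continuous injection from a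
compact space into a Hausdorff space is a closed embedding. -/
theorem isEmbedding_localMap [Finite ι] : IsEmbedding (localMap π k) := by
  have := finite_partVertex π k
  have := finite_partEdge π k
  have := (partGraph π k).compactSpace_space
  have := t2Space_localGraph π
  have := (localGraph π).t2Space_unordConf (localSinks π) k
  exact ((continuous_localMap π k).isClosedEmbedding (localMap_injective k)).isEmbedding

/-- `localMap` as a homotopy equivalence. -/
noncomputable def localHomotopyEquiv [Finite ι] :
    ContinuousMap.HomotopyEquiv (partGraph π k).Space (LocalConf π k) where
  toFun := ⟨localMap π k, continuous_localMap π k⟩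
  invFun := ⟨fun y => (isEmbedding_localMap π k).toHomeomorph.symm ⟨flow (1, y), flow_one_mem_range y⟩,
    (isEmbedding_localMap π k).toHomeomorph.symm.continuous.comp
      ((continuous_flow.comp (Continuous.prodMk_right 1)).subtype_mk _)⟩
  left_inv := by
    -- This composite is the identity on the nose, because `flow` at time `1` fixes the image of
    -- `localMap`.
    convert ContinuousMap.Homotopic.refl _
    ext z
    refine (isEmbedding_localMap π k).toHomeomorph.injective (Subtype.ext ?_)
    simpa using (flow_one_localMap z).symm
  right_inv := by
    -- `flow` runs from the identity to the composite, hence the reversal.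
    refine ContinuousMap.Homotopic.symm ⟨⟨⟨flow, continuous_flow⟩, flow_zero, fun y => ?_⟩⟩
    exact congrArg Subtype.val ((isEmbedding_localMap π k).toHomeomorph.apply_symm_apply
      ⟨flow (1, y), flow_one_mem_range y⟩).symm

end LocalMap

end LocalGraph

theorem proposition4p9 {ι : Type u} [Finite ι] (π : Setoid ι) (k : ℕ) :
    (∃ e : ContinuousMap.HomotopyEquiv (partGraph π k).Space (LocalConf π k),
      ⇑e.toFun = localMap π k) ∧
    (∃ (V E : Type u) (G : TopGraph V E), Finite V ∧ Finite E ∧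
      Nonempty (ContinuousMap.HomotopyEquiv (LocalConf π k) G.Space)) :=
  ⟨⟨LocalGraph.localHomotopyEquiv π k, rfl⟩, _, _, partGraph π k,
    LocalGraph.finite_partVertex π k, LocalGraph.finite_partEdge π k,
    ⟨(LocalGraph.localHomotopyEquiv π k).symm⟩⟩
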